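/- Let $(\Omega,\Sigma,\mu)$ be a $\sigma$-finite measure space and let $\bar\varphi_0,\bar\varphi_1$ be two probability densities with respect to $\mu$ (for instance PDFs with respect to Lebesgue measure, or PMFs with respect to counting measure on a countable set) such that both Kullback–Leibler divergences $\int \bar\varphi_0\log\frac{\bar\varphi_0}{\bar\varphi_1}\,d\mu$ and $\int \bar\varphi_1\log\frac{\bar\varphi_1}{\bar\varphi_0}\,d\mu$ are positive and finite (so the two distributions are mutually absolutely continuous and distinct). Let $$D^*(\bar\varphi_0,\bar\varphi_1)=\sup_{\alpha\in(0,1)}\Big(-\log\int\bar\varphi_0^{1-\alpha}\bar\varphi_1^{\alpha}\,d\mu\Big)$$ be the Chernoff information. For $n\ge 1$ and $z\in\{0,1\}$ let $\varphi_z^{(n)}(x)=\prod_{j=1}^n\bar\varphi_z(x_j)$, a density on $\Omega^n$ with respect to $\mu^{\otimes n}$, and let $\eta(\varphi_0^{(n)},\varphi_1^{(n)})=\int_{\Omega^n}\min(\varphi_0^{(n)},\varphi_1^{(n)})\,d\mu^{\otimes n}$ be the total variation affinity. Then, as $n\to\infty$, $$\eta(\varphi_0^{(n)},\varphi_1^{(n)})=\Theta\Big(\frac1{\sqrt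 n}\,e^{-nD^*(\bar\varphi_0,\bar\varphi_1)}\Big),$$ with constants that may depend on $\bar\varphi_0,\bar\varphi_1$ and $\mu$. Consequently $$\log\eta(\varphi_0^{(n)},\varphi_1^{(n)})=-nD^*(\bar\varphi_0,\bar\varphi_1)-\tfrac12\log n+O(1),$$ and the same expansion holds for $\log R_n$, where $R_n=\frac12\sum_{z\in\{0,1\}}P_z^{(n)}(\hat z_n\neq z)$ is the Bayes error probability, $P_z^{(n)}$ being the distribution with density $\varphi_z^{(n)}$ and $\hat z_n$ any measurable selection $\hat z_n(x)\in\arg\max_{z\in\{0,1\}}\varphi_z^{(n)}(x)$. -/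

import Mathlib

open MeasureTheory Filter Asymptotics Set
open scoped ENNReal

noncomputable section

namespace BayesChernoff

variable {Ω : Type*} [MeasurableSpace Ω]

/-- `φ` is a probability density with respect to `μ` (a PDF if `μ` is Lebesgue measure, a PMF if
`μ` is counting measure). -/
structure IsDensity (μ : Measure Ω) (φ : Ω → ℝ) : Prop where
  measurable : Measurable φ
  nonneg : ∀ x, 0 ≤ φ x
  lintegral_eq_one : ∫⁻ x, ENNReal.ofReal (φ x) ∂μ = 1

/-- The distribution with density `φ` with respect to `μ`. -/
def law (μ : Measure Ω) (φ : Ω → ℝ) : Measure Ω :=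
  μ.withDensity fun x => ENNReal.ofReal (φ x)

/-- Pairs of densities whose Kullback–Leibler divergences in both directions are positive real
numbers. -/
structure IsAdmissible (μ : Measure Ω) (φ : Fin 2 → Ω → ℝ) : Prop where
  isDensity : ∀ z, IsDensity μ (φ z)
  kl_pos : 0 < InformationTheory.klDiv (law μ (φ 0)) (law μ (φ 1))
  kl_lt_top : InformationTheory.klDiv (law μ (φ 0)) (law μ (φ 1)) < ∞
  kl_pos' : 0 < InformationTheory.klDiv (law μ (φ 1)) (law μ (φ 0))
  kl_lt_top' : InformationTheory.klDiv (law μ (φ 1)) (law μ (φ 0)) < ∞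

/-- The `n`-fold product density `x ↦ ∏ j, φ (x j)`. -/
def iidDensity (n : ℕ) (φ : Ω → ℝ) (x : Fin n → Ω) : ℝ := ∏ j, φ (x j)

/-- The total variation affinity `η(φ₀, φ₁) = ∫ min(φ₀, φ₁) dμ`. -/
def affinity (μ : Measure Ω) (φ : Fin 2 → Ω → ℝ) : ℝ := ∫ x, min (φ 0 x) (φ 1 x) ∂μ

/-- The Chernoff `α`-divergence `-log ∫ φ₀^(1-α) φ₁^α dμ`. -/
def chernoffDiv (μ : Measure Ω) (φ : Fin 2 → Ω → ℝ) (α : ℝ) : ℝ :=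
  -Real.log (∫ x, φ 0 x ^ (1 - α) * φ 1 x ^ α ∂μ)

/-- The Chernoff information, the supremum over `α ∈ (0,1)` of the Chernoff `α`-divergence
(for an admissible pair this is a supremum of a nonempty bounded set). -/
def chernoffInfo (μ : Measure Ω) (φ : Fin 2 → Ω → ℝ) : ℝ :=
  ⨆ α : Ioo (0 : ℝ) 1, chernoffDiv μ φ α

/-- A Bayes estimator: a measurable choice of `argmax_z φ_z(x)` (ties broken arbitrarily). -/
def IsBayesEstimator (φ : Fin 2 → Ω → ℝ) (zhat : Ω → Fin 2) : Prop :=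
  Measurable zhat ∧ ∀ x z, φ z x ≤ φ (zhat x) x

/-- The error probability `R(ẑ, z) = ½ ∑_z P_z(ẑ ≠ z)` of an estimator `ẑ`. -/
def errorProb (μ : Measure Ω) (φ : Fin 2 → Ω → ℝ) (zhat : Ω → Fin 2) : ℝ :=
  1 / 2 * ∑ z, (law μ (φ z)).real {x | zhat x ≠ z}

end BayesChernoff

end

/-! The Chernoff coefficient `Z(α) = ∫ φ₀^(1-α) φ₁^α` is the moment generating function of the
log-likelihood ratio `X = log (φ₁/φ₀)` under `φ₀`. It equals `1` at both endpoints and is less than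
`1` at `1/2` (a Hellinger identity), so it has a minimiser `α` inside `(0,1)`, and `-log Z(α)` is
the Chernoff information. Tilting to the law `Q` with density `φ₀^(1-α) φ₁^α / Z(α)` makes `X`
centred, because `Z'(α) = 0`, with positive finite variance. With `S` the sum of the `X(x_j)`, this
change of measure (`affinity_eq`) gives `η_n = Z(α)^n E[min(e^(-αS), e^((1-α)S))]` under `Q^n`.

The exponential factor is now exact. It remains to see that a function of `S` with two-sided
exponential decay has expectation of order `1/√n` (`integral_isTheta_inv_sqrt`). Only the order
matters, so lattice and non-lattice laws need no separate treatment: a Fejér kernel has a transform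
supported in `[-δ, δ]`, and its expectation involves the characteristic function only near `0`,
where a second moment controls it. This yields mass `O(1/√n)` for every unit ball
(`measure_closedBall_le`), hence the upper bound, and expectation at least `1/√n` for the kernel
itself, hence the lower bound once its tail is removed. -/

open scoped Topology

namespace BayesChernoff

/-! ### Order `1/√n` for sums of centred i.i.d. variables, by Fejér kernels -/

section LocalLimit

/-- Near `0` the error in the second-order expansion `1 - t²/2` is at most `t²/4`, and `1 - t²/4 ≤
e^(-t²/4)`. The condition `δ ≤ 1` is also used in `le_fejer`. -/
lemma exists_norm_charFun_le_exp {ν : Measure ℝ} [IsProbabilityMeasure ν]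
    (h0 : ∫ x, x ∂ν = 0) (h1 : ∫ x, x ^ 2 ∂ν = 1) :
    ∃ δ : ℝ, 0 < δ ∧ δ ≤ 1 ∧ ∀ t, |t| ≤ δ → ‖charFun ν t‖ ≤ Real.exp (-t ^ 2 / 4) := by
  have h := taylor_charFun_two (P := ν) (X := id) aemeasurable_id (by simpa using h0)
    (by simpa using h1)
  rw [Measure.map_id] at h
  have h' := h.bound (show (0 : ℝ) < 1 / 4 by norm_num)
  obtain ⟨ε, hε, hb⟩ := Metric.eventually_nhds_iff.1 h'
  refine ⟨min (ε / 2) 1, by positivity, min_le_right _ _, fun t ht => ?_⟩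
  have ht1 : |t| ≤ 1 := ht.trans (min_le_right _ _)
  have ht2 : |t| ≤ ε / 2 := ht.trans (min_le_left _ _)
  have hb' := hb (y := t) (by rw [Real.dist_eq]; simpa using by linarith)
  have ht3 : t ^ 2 ≤ 1 := by rw [← sq_abs]; nlinarith [abs_nonneg t]
  have e1 : ‖(1 : ℂ) - t ^ 2 / 2‖ = 1 - t ^ 2 / 2 := by
    have : (1 : ℂ) - t ^ 2 / 2 = ((1 - t ^ 2 / 2 : ℝ) : ℂ) := by push_cast; ring
    rw [this, Complex.norm_real, Real.norm_eq_abs, abs_of_nonneg (by linarith)]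
  have e2 : ‖t ^ 2‖ = t ^ 2 := by rw [Real.norm_eq_abs, abs_of_nonneg (sq_nonneg t)]
  rw [e2] at hb'
  calc ‖charFun ν t‖ = ‖((1 : ℂ) - t ^ 2 / 2) + (charFun ν t - (1 - t ^ 2 / 2))‖ := by ring_nf
    _ ≤ ‖(1 : ℂ) - t ^ 2 / 2‖ + ‖charFun ν t - (1 - t ^ 2 / 2)‖ := norm_add_le _ _
    _ ≤ (1 - t ^ 2 / 2) + 1 / 4 * t ^ 2 := by rw [e1]; gcongr
    _ = -t ^ 2 / 4 + 1 := by ring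
    _ ≤ Real.exp (-t ^ 2 / 4) := Real.add_one_le_exp _

/-- The Fejér kernel, up to normalisation: the cosine transform of a triangle function supported
on `[-δ, δ]`. -/
noncomputable def fejer (δ s : ℝ) : ℝ := ∫ t in (0 : ℝ)..δ, (1 - t / δ) * Real.cos (t * s)

lemma fejer_eq {δ s : ℝ} (hδ : 0 < δ) (hs : s ≠ 0) :
    fejer δ s = (1 - Real.cos (δ * s)) / (δ * s ^ 2) := by
  have key : ∀ t ∈ uIcc 0 δ, HasDerivAt
      (fun t => (1 - t / δ) * (Real.sin (t * s) / s) - Real.cos (t * s) / (δ * s ^ 2))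
      ((1 - t / δ) * Real.cos (t * s)) t := by
    intro t _
    have hm : HasDerivAt (fun t : ℝ => t * s) s t := by simpa using (hasDerivAt_id t).mul_const s
    have h1 : HasDerivAt (fun t : ℝ => 1 - t / δ) (-(1 / δ)) t := by
      simpa using ((hasDerivAt_id t).div_const δ).const_sub 1
    have := (h1.mul ((hm.sin).div_const s)).sub ((hm.cos).div_const (δ * s ^ 2))
    refine this.congr_deriv ?_
    field_simp
    ring
  rw [fejer, intervalIntegral.integral_eq_sub_of_hasDerivAt key
    (Continuous.intervalIntegrable (by fun_prop) _ _)]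
  have : δ ≠ 0 := hδ.ne'
  simp only [zero_mul, Real.sin_zero, Real.cos_zero, zero_div, mul_zero]
  rw [div_self this]
  ring

lemma fejer_zero {δ : ℝ} (hδ : 0 < δ) : fejer δ 0 = δ / 2 := by
  have : δ ≠ 0 := hδ.ne'
  simp only [fejer, mul_zero, Real.cos_zero, mul_one]
  rw [intervalIntegral.integral_sub (by simp) (Continuous.intervalIntegrable (by fun_prop) _ _)]
  simp only [intervalIntegral.integral_const, intervalIntegral.integral_div, integral_id]
  simp
  field_simp
  ring

lemma fejer_nonneg {δ : ℝ} (hδ : 0 < δ) (s : ℝ) : 0 ≤ fejer δ s := by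
  rcases eq_or_ne s 0 with rfl | hs
  · rw [fejer_zero hδ]; positivity
  · rw [fejer_eq hδ hs]
    have := Real.cos_le_one (δ * s)
    exact div_nonneg (by linarith) (by positivity)

lemma fejer_le {δ s : ℝ} (hδ : 0 < δ) (hs : s ≠ 0) : fejer δ s ≤ 2 / δ * (1 / s ^ 2) := by
  rw [fejer_eq hδ hs, div_mul_div_comm, mul_one]
  have := Real.neg_one_le_cos (δ * s)
  gcongr
  linarith

lemma le_fejer {δ s : ℝ} (hδ : 0 < δ) (hδ1 : δ ≤ 1) (hs : |s| ≤ 1) : δ / 8 ≤ fejer δ s := by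
  rcases eq_or_ne s 0 with rfl | hs0
  · rw [fejer_zero hδ]; linarith
  · rw [fejer_eq hδ hs0]
    have hb : |δ * s| ≤ 1 := by
      rw [abs_mul, abs_of_pos hδ]; nlinarith [abs_nonneg s]
    -- Jordan-type bound `1 - cos x ≥ (2/π²) x²` for `|x| ≤ π`; then `π ≤ 4` gives the constant
    -- `1/8`.
    have h := Real.cos_le_one_sub_mul_cos_sq (hb.trans (by linarith [Real.pi_gt_three]))
    have hpi : 1 / 8 ≤ 2 / Real.pi ^ 2 := by
      rw [div_le_div_iff₀ (by norm_num) (by positivity)]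
      nlinarith [Real.pi_le_four, Real.pi_pos]
    rw [le_div_iff₀ (by positivity)]
    have : 1 / 8 * (δ * s) ^ 2 ≤ 2 / Real.pi ^ 2 * (δ * s) ^ 2 := by gcongr
    calc δ / 8 * (δ * s ^ 2) = 1 / 8 * (δ * s) ^ 2 := by ring
      _ ≤ _ := by linarith

lemma continuous_fejer (δ : ℝ) : Continuous (fejer δ) := by
  unfold fejer
  exact intervalIntegral.continuous_parametric_intervalIntegral_of_continuous' (by fun_prop) _ _

lemma norm_fejer_le {δ : ℝ} (hδ : 0 < δ) (s : ℝ) : ‖fejer δ s‖ ≤ δ := by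
  have := intervalIntegral.norm_integral_le_of_norm_le_const (a := 0) (b := δ) (C := 1)
    (f := fun t => (1 - t / δ) * Real.cos (t * s)) ?_
  · simpa [fejer, abs_of_pos hδ] using this
  · intro t ht
    rw [uIoc_of_le hδ.le] at ht
    have h1 : t / δ ≤ 1 := (div_le_one hδ).2 ht.2
    have h2 : 0 ≤ t / δ := div_nonneg ht.1.le hδ.le
    rw [norm_mul, Real.norm_eq_abs, Real.norm_eq_abs, abs_of_nonneg (by linarith)]
    nlinarith [Real.abs_cos_le_one (t * s), abs_nonneg (Real.cos (t * s))]

lemma re_exp_mul_charFun (ρ : Measure ℝ) [IsProbabilityMeasure ρ] (a t : ℝ) :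
    ∫ s, Real.cos (t * (s - a)) ∂ρ
      = (Complex.exp (-(t * a : ℝ) * Complex.I) * charFun ρ t).re := by
  rw [charFun_apply_real, ← integral_const_mul]
  have hint : Integrable
      (fun s : ℝ => Complex.exp (-(t * a : ℝ) * Complex.I) * Complex.exp (t * s * Complex.I)) ρ := by
    refine Integrable.of_bound (Continuous.aestronglyMeasurable (by fun_prop)) 1 (ae_of_all _ ?_)
    intro s
    rw [← Complex.exp_add, ← add_mul]
    have : (-(t * a : ℝ) + (t : ℂ) * s) = ((-(t * a) + t * s : ℝ) : ℂ) := by push_cast; ring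
    rw [this, Complex.norm_exp_ofReal_mul_I]
  have := integral_re hint
  simp only [RCLike.re_eq_complex_re] at this
  rw [← this]
  refine integral_congr_ae (ae_of_all _ fun s => ?_)
  simp only
  rw [← Complex.exp_add, ← add_mul]
  have : (-(t * a : ℝ) + (t : ℂ) * s) = ((t * (s - a) : ℝ) : ℂ) := by push_cast; ring
  rw [this, Complex.exp_ofReal_mul_I_re]

/-- Parseval by Fubini: only the values of the characteristic function on `[0, δ]` enter. -/
lemma integral_fejer_sub (ρ : Measure ℝ) [IsProbabilityMeasure ρ] {δ : ℝ} (a : ℝ) :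
    ∫ s, fejer δ (s - a) ∂ρ = ∫ t in (0 : ℝ)..δ,
      (1 - t / δ) * (Complex.exp (-(t * a : ℝ) * Complex.I) * charFun ρ t).re := by
  have : ∀ t : ℝ, (1 - t / δ) * (Complex.exp (-(t * a : ℝ) * Complex.I) * charFun ρ t).re
      = ∫ s, (1 - t / δ) * Real.cos (t * (s - a)) ∂ρ := fun t => by
    rw [integral_const_mul, re_exp_mul_charFun]
  simp only [this, fejer]
  rw [intervalIntegral_integral_swap]
  have h1 : Integrable (fun t : ℝ => (1 - t / δ)) (volume.restrict (uIoc 0 δ)) :=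
    ((by fun_prop : Continuous fun t : ℝ => (1 - t / δ)).integrableOn_uIcc).mono_set uIoc_subset_uIcc
  have h2 := h1.mul_prod (integrable_const (1 : ℝ) (μ := ρ))
  refine h2.mono (Continuous.aestronglyMeasurable (by fun_prop)) (ae_of_all _ fun z => ?_)
  simp only [Function.uncurry, norm_mul, mul_one]
  exact mul_le_of_le_one_right (norm_nonneg _) (Real.abs_cos_le_one _)

lemma integral_fejer_sub_le {ν : Measure ℝ} {δ : ℝ} (hδ : 0 < δ)
    (hb : ∀ t, |t| ≤ δ → ‖charFun ν t‖ ≤ Real.exp (-t ^ 2 / 4))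
    {ρ : Measure ℝ} [IsProbabilityMeasure ρ] {n : ℕ} (hn : 0 < n)
    (hρ : ∀ t, charFun ρ t = charFun ν t ^ n) (a : ℝ) :
    ∫ s, fejer δ (s - a) ∂ρ ≤ √Real.pi / √n := by
  have hn' : (0 : ℝ) < n := by exact_mod_cast hn
  rw [integral_fejer_sub]
  have hg : Integrable (fun t : ℝ => Real.exp (-(n / 4 : ℝ) * t ^ 2)) :=
    integrable_exp_neg_mul_sq (by positivity)
  have hpt : ∀ t ∈ Ioc 0 δ,
      ‖(1 - t / δ) * (Complex.exp (-(t * a : ℝ) * Complex.I) * charFun ρ t).re‖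
        ≤ Real.exp (-(n / 4 : ℝ) * t ^ 2) := by
    intro t ht
    have h1 : t / δ ≤ 1 := (div_le_one hδ).2 ht.2
    have h2 : 0 ≤ t / δ := div_nonneg ht.1.le hδ.le
    have h3 : |(Complex.exp (-(t * a : ℝ) * Complex.I) * charFun ρ t).re|
        ≤ Real.exp (-(n / 4 : ℝ) * t ^ 2) := by
      refine (Complex.abs_re_le_norm _).trans ?_
      have : (-((t * a : ℝ) : ℂ)) = ((-(t * a) : ℝ) : ℂ) := by push_cast; ring
      rw [norm_mul, this, Complex.norm_exp_ofReal_mul_I, one_mul, hρ, norm_pow]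
      calc ‖charFun ν t‖ ^ n ≤ Real.exp (-t ^ 2 / 4) ^ n := by
            gcongr
            exact hb t (by rw [abs_of_pos ht.1]; exact ht.2)
        _ = _ := by rw [← Real.exp_nat_mul]; congr 1; ring
    rw [norm_mul, Real.norm_eq_abs, Real.norm_eq_abs, abs_of_nonneg (by linarith)]
    nlinarith [abs_nonneg (Complex.exp (-(t * a : ℝ) * Complex.I) * charFun ρ t).re]
  calc _ ≤ ‖∫ t in (0 : ℝ)..δ,
          (1 - t / δ) * (Complex.exp (-(t * a : ℝ) * Complex.I) * charFun ρ t).re‖ :=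
        Real.le_norm_self _
    _ ≤ ∫ t in (0 : ℝ)..δ, Real.exp (-(n / 4 : ℝ) * t ^ 2) :=
        intervalIntegral.norm_integral_le_of_norm_le hδ.le (ae_of_all _ hpt) hg.intervalIntegrable
    _ = ∫ t in Ioc 0 δ, Real.exp (-(n / 4 : ℝ) * t ^ 2) :=
        intervalIntegral.integral_of_le hδ.le
    _ ≤ ∫ t in Ioi 0, Real.exp (-(n / 4 : ℝ) * t ^ 2) :=
        setIntegral_mono_set hg.integrableOn (ae_of_all _ fun t => (Real.exp_pos _).le)
          (Ioc_subset_Ioi_self.eventuallyLE)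
    -- Half the Gaussian integral: `½ √(4π/n)`.
    _ = √Real.pi / √n := by
        rw [integral_gaussian_Ioi, show Real.pi / (n / 4 : ℝ) = 2 ^ 2 * (Real.pi / n) by
          field_simp; norm_num, Real.sqrt_mul (by positivity), Real.sqrt_sq (by norm_num),
          Real.sqrt_div Real.pi_pos.le]
        ring

lemma integrable_fejer_sub {δ : ℝ} (hδ : 0 < δ) (ρ : Measure ℝ) [IsProbabilityMeasure ρ] (a : ℝ) :
    Integrable (fun s => fejer δ (s - a)) ρ :=
  Integrable.of_bound
    ((continuous_fejer δ).comp (continuous_id.sub continuous_const)).aestronglyMeasurable δ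
    (ae_of_all _ fun _ => norm_fejer_le hδ _)

/-- Concentration bound: balls of radius `1` have mass at most `C / √n`. -/
lemma measure_closedBall_le {ν : Measure ℝ} {δ : ℝ} (hδ : 0 < δ) (hδ1 : δ ≤ 1)
    (hb : ∀ t, |t| ≤ δ → ‖charFun ν t‖ ≤ Real.exp (-t ^ 2 / 4))
    {ρ : Measure ℝ} [IsProbabilityMeasure ρ] {n : ℕ} (hn : 0 < n)
    (hρ : ∀ t, charFun ρ t = charFun ν t ^ n) (a : ℝ) :
    ρ (Metric.closedBall a 1) ≤ ENNReal.ofReal (8 / δ * √Real.pi / √n) := by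
  rw [← ofReal_measureReal]
  refine ENNReal.ofReal_le_ofReal ?_
  have h := mul_meas_ge_le_integral_of_nonneg (μ := ρ) (ae_of_all _ fun s => fejer_nonneg hδ (s - a))
    (integrable_fejer_sub hδ ρ a) (δ / 8)
  have hsub : Metric.closedBall a 1 ⊆ {s | δ / 8 ≤ fejer δ (s - a)} := by
    intro s hs
    rw [Metric.mem_closedBall, Real.dist_eq] at hs
    exact le_fejer hδ hδ1 hs
  have h2 := measureReal_mono (μ := ρ) hsub
  have h3 := integral_fejer_sub_le hδ hb hn hρ a
  have h4 : δ / 8 * ρ.real (Metric.closedBall a 1) ≤ √Real.pi / √n :=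
    (mul_le_mul_of_nonneg_left h2 (by positivity)).trans (h.trans h3)
  calc ρ.real (Metric.closedBall a 1) = 8 / δ * (δ / 8 * ρ.real (Metric.closedBall a 1)) := by
        field_simp
    _ ≤ 8 / δ * (√Real.pi / √n) := by gcongr
    _ = _ := by ring

/-- If all balls of radius `1` have `ρ`-mass at most `C`, then `∫ g dρ` is controlled by the Lebesgue
integral of any `h` dominating `g` on unit neighbourhoods. -/
lemma lintegral_le_of_measure_closedBall_le {ρ : Measure ℝ} [IsProbabilityMeasure ρ] {C : ℝ≥0∞}
    (hC : ∀ a, ρ (Metric.closedBall a 1) ≤ C) {g h : ℝ → ℝ≥0∞} (hh : Measurable h)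
    (hgh : ∀ s a, |s - a| ≤ 1 → g s ≤ h a) :
    ∫⁻ s, g s ∂ρ ≤ C * ∫⁻ a, h a := by
  have hm : MeasurableSet {p : ℝ × ℝ | |p.1 - p.2| ≤ 1} :=
    measurableSet_le (by fun_prop) measurable_const
  -- The unit ball about `s` has Lebesgue measure `2 ≥ 1`, so integrating the constant `g s` over it
  -- loses nothing. Tonelli then exchanges the roles of `s` and `a`.
  have h1 : ∀ s, g s ≤ ∫⁻ a, {p : ℝ × ℝ | |p.1 - p.2| ≤ 1}.indicator (fun p => h p.2) (s, a) := by
    intro s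
    calc g s ≤ ∫⁻ _ in Metric.closedBall s 1, g s := by
          rw [setLIntegral_const, Real.volume_closedBall]
          exact le_mul_of_one_le_right' (by simp)
      _ = ∫⁻ a, (Metric.closedBall s 1).indicator (fun _ => g s) a :=
          (lintegral_indicator Metric.isClosed_closedBall.measurableSet _).symm
      _ ≤ _ := by
          refine lintegral_mono fun a => ?_
          by_cases ha : |s - a| ≤ 1
          · have : a ∈ Metric.closedBall s 1 := by
              rwa [Metric.mem_closedBall, Real.dist_eq, abs_sub_comm]
            simp [indicator, ha, hgh s a ha, this]
          · have : a ∉ Metric.closedBall s 1 := by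
              rwa [Metric.mem_closedBall, Real.dist_eq, abs_sub_comm]
            simp [indicator, this]
  calc ∫⁻ s, g s ∂ρ
      ≤ ∫⁻ s, (∫⁻ a, {p : ℝ × ℝ | |p.1 - p.2| ≤ 1}.indicator (fun p => h p.2) (s, a)) ∂ρ :=
        lintegral_mono h1
    _ = ∫⁻ a, ∫⁻ s, {p : ℝ × ℝ | |p.1 - p.2| ≤ 1}.indicator (fun p => h p.2) (s, a) ∂ρ :=
        lintegral_lintegral_swap (f := fun s a =>
          {p : ℝ × ℝ | |p.1 - p.2| ≤ 1}.indicator (fun p => h p.2) (s, a))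
          (((hh.comp measurable_snd).indicator hm).aemeasurable)
    _ ≤ ∫⁻ a, C * h a := by
        refine lintegral_mono fun a => ?_
        have : ∀ s, {p : ℝ × ℝ | |p.1 - p.2| ≤ 1}.indicator (fun p => h p.2) (s, a)
            = (Metric.closedBall a 1).indicator (fun _ => h a) s := by
          intro s
          simp [indicator, Metric.mem_closedBall, Real.dist_eq]
        simp only [this]
        rw [lintegral_indicator Metric.isClosed_closedBall.measurableSet, setLIntegral_const,
          mul_comm]
        gcongr
        exact hC a
    _ = C * ∫⁻ a, h a := lintegral_const_mul _ hh

/-! ### The polynomial weight `(1 + |s|)^(-3/2)` -/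

/-- The exponent `3/2` lies strictly between `1`, for Lebesgue integrability, and `2`, the decay of
the Fejér kernel. The spare half power makes the kernel's tail small in `fejer_le_indicator_add`. -/
lemma integrable_one_add_abs_rpow : Integrable fun s : ℝ => (1 + |s|) ^ (-(3 / 2) : ℝ) := by
  have := integrable_one_add_norm (E := ℝ) (μ := volume) (r := 3 / 2) (by norm_num)
  simpa using this

lemma one_add_abs_rpow_le {s a : ℝ} (hsa : |s - a| ≤ 1) :
    (1 + |s|) ^ (-(3 / 2) : ℝ) ≤ 4 * (1 + |a|) ^ (-(3 / 2) : ℝ) := by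
  have h1 : |a| ≤ |s| + 1 := by
    have := abs_sub_abs_le_abs_sub a s
    rw [abs_sub_comm a s] at this; linarith
  have hs := abs_nonneg s
  have ha := abs_nonneg a
  have h2 : (1 + |s|) ^ (-(3 / 2) : ℝ) ≤ ((1 + |a|) / 2) ^ (-(3 / 2) : ℝ) :=
    Real.rpow_le_rpow_of_nonpos (by positivity) (by linarith) (by norm_num)
  refine h2.trans ?_
  rw [Real.div_rpow (by positivity) (by norm_num), div_eq_mul_inv, mul_comm,
    ← Real.rpow_neg (by norm_num)]
  gcongr
  calc (2 : ℝ) ^ (-(-(3 / 2)) : ℝ) ≤ 2 ^ (2 : ℝ) :=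
        Real.rpow_le_rpow_of_exponent_le (by norm_num) (by norm_num)
    _ = 4 := by norm_num

lemma continuous_one_add_abs_rpow : Continuous fun s : ℝ => (1 + |s|) ^ (-(3 / 2) : ℝ) :=
  Continuous.rpow_const (by fun_prop) fun s => Or.inl (by positivity)

lemma one_add_abs_rpow_nonneg (s : ℝ) : 0 ≤ (1 + |s|) ^ (-(3 / 2) : ℝ) :=
  Real.rpow_nonneg (by positivity) _

lemma integrable_one_add_abs_rpow' (ρ : Measure ℝ) [IsProbabilityMeasure ρ] :
    Integrable (fun s : ℝ => (1 + |s|) ^ (-(3 / 2) : ℝ)) ρ := by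
  refine Integrable.of_bound continuous_one_add_abs_rpow.aestronglyMeasurable 1
    (ae_of_all _ fun s => ?_)
  rw [Real.norm_eq_abs, abs_of_nonneg (one_add_abs_rpow_nonneg s)]
  exact Real.rpow_le_one_of_one_le_of_nonpos (by linarith [abs_nonneg s]) (by norm_num)

lemma integral_one_add_abs_rpow_le {ρ : Measure ℝ} [IsProbabilityMeasure ρ] {B : ℝ}
    (hB : 0 ≤ B) (hC : ∀ a, ρ (Metric.closedBall a 1) ≤ ENNReal.ofReal B) :
    ∫ s, (1 + |s|) ^ (-(3 / 2) : ℝ) ∂ρ ≤ B * (4 * ∫ s, (1 + |s|) ^ (-(3 / 2) : ℝ)) := by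
  have h := lintegral_le_of_measure_closedBall_le hC
    (g := fun s => ENNReal.ofReal ((1 + |s|) ^ (-(3 / 2) : ℝ)))
    (h := fun s => ENNReal.ofReal (4 * (1 + |s|) ^ (-(3 / 2) : ℝ)))
    (by have := continuous_one_add_abs_rpow.measurable; fun_prop)
    (fun s a hsa => ENNReal.ofReal_le_ofReal (one_add_abs_rpow_le hsa))
  have h0 : ∀ s : ℝ, 0 ≤ 4 * (1 + |s|) ^ (-(3 / 2) : ℝ) := fun s =>
    mul_nonneg (by norm_num) (one_add_abs_rpow_nonneg s)
  rw [integral_eq_lintegral_of_nonneg_ae (ae_of_all _ one_add_abs_rpow_nonneg)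
    continuous_one_add_abs_rpow.aestronglyMeasurable, ← integral_const_mul,
    ← ENNReal.toReal_ofReal hB, ← ENNReal.toReal_ofReal (integral_nonneg h0), ← ENNReal.toReal_mul]
  refine ENNReal.toReal_mono (by finiteness) ?_
  rwa [ofReal_integral_eq_lintegral_ofReal (integrable_one_add_abs_rpow.const_mul 4)
    (ae_of_all _ h0)]

/-- From `e^x ≥ 1 + x²/2` for `x ≥ 0`; the constant is chosen so that `(2 + 4/c²)(1 + c²s²/2)`
dominates `2 + 2s² ≥ (1 + |s|)²`. -/
lemma exp_neg_mul_abs_le {c : ℝ} (hc : 0 < c) (s : ℝ) :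
    Real.exp (-(c * |s|)) ≤ (2 + 4 / c ^ 2) * (1 + |s|) ^ (-(3 / 2) : ℝ) := by
  have hs := abs_nonneg s
  have h1 : (1 + |s|) ^ 2 ≤ (2 + 4 / c ^ 2) * Real.exp (c * |s|) := by
    have h2 := Real.quadratic_le_exp_of_nonneg (show 0 ≤ c * |s| by positivity)
    have h3 : 1 + c ^ 2 * |s| ^ 2 / 2 ≤ Real.exp (c * |s|) := by
      nlinarith [mul_nonneg hc.le hs]
    calc (1 + |s|) ^ 2 ≤ 2 + 2 * |s| ^ 2 := by nlinarith [sq_nonneg (1 - |s|)]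
      _ ≤ (2 + 4 / c ^ 2) * (1 + c ^ 2 * |s| ^ 2 / 2) := by
          have : (2 + 4 / c ^ 2) * (1 + c ^ 2 * |s| ^ 2 / 2)
              = 2 + 2 * |s| ^ 2 + (c ^ 2 * |s| ^ 2 + 4 / c ^ 2) := by field_simp; ring
          rw [this]
          have : 0 ≤ c ^ 2 * |s| ^ 2 + 4 / c ^ 2 := by positivity
          linarith
      _ ≤ _ := by gcongr
  have h4 : (1 + |s|) ^ (3 / 2 : ℝ) ≤ (1 + |s|) ^ 2 := by
    rw [← Real.rpow_natCast]
    exact Real.rpow_le_rpow_of_exponent_le (by linarith) (by norm_num)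
  rw [Real.rpow_neg (by positivity), Real.exp_neg, ← div_eq_mul_inv,
    le_div_iff₀ (by positivity), inv_mul_le_iff₀ (Real.exp_pos _), mul_comm]
  rw [mul_comm] at h1
  linarith

lemma integrable_exp_neg_mul_abs {c : ℝ} (hc : 0 < c) (ρ : Measure ℝ) [IsProbabilityMeasure ρ] :
    Integrable (fun s => Real.exp (-(c * |s|))) ρ :=
  Integrable.of_bound (Continuous.aestronglyMeasurable (by fun_prop)) 1 (ae_of_all _ fun s => by
    rw [Real.norm_eq_abs, Real.abs_exp]
    exact Real.exp_le_one_iff.2 (by have := abs_nonneg s; nlinarith))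

/-- Inside `[-M, M]` the trivial bound `δ` suffices. Outside, the kernel is at most `2/(δ s²)`, and
half a power of `1 + |s|` is traded for `1/√M`. -/
lemma fejer_le_indicator_add {δ : ℝ} (hδ : 0 < δ) {M : ℝ} (hM : 1 ≤ M) (s : ℝ) :
    fejer δ s ≤ (Icc (-M) M).indicator (fun _ => δ) s
      + 8 / (δ * √M) * (1 + |s|) ^ (-(3 / 2) : ℝ) := by
  have h0 : 0 ≤ 8 / (δ * √M) * (1 + |s|) ^ (-(3 / 2) : ℝ) :=
    mul_nonneg (by positivity) (one_add_abs_rpow_nonneg s)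
  by_cases hs : s ∈ Icc (-M) M
  · rw [indicator_of_mem hs]
    have := (Real.le_norm_self _).trans (norm_fejer_le hδ s)
    linarith
  · rw [indicator_of_notMem hs, zero_add]
    have hs' : M < |s| := by
      by_contra! h
      exact hs (abs_le.1 h)
    have hs0 : s ≠ 0 := by rintro rfl; simp at hs'; linarith
    refine (fejer_le hδ hs0).trans ?_
    have h1 : 1 / s ^ 2 ≤ 4 * (1 + |s|) ^ (-2 : ℝ) := by
      rw [Real.rpow_neg (by positivity), ← div_eq_mul_inv,
        div_le_div_iff₀ (by positivity) (by positivity), ← sq_abs s]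
      rw [Real.rpow_two]
      nlinarith
    have h2 : (1 + |s|) ^ (-2 : ℝ) ≤ (1 + |s|) ^ (-(3 / 2) : ℝ) * (1 / √M) := by
      rw [show (-2 : ℝ) = -(3 / 2) + -(1 / 2) by norm_num, Real.rpow_add (by positivity)]
      refine mul_le_mul_of_nonneg_left ?_ (one_add_abs_rpow_nonneg s)
      rw [Real.rpow_neg (by positivity), ← Real.sqrt_eq_rpow, ← one_div]
      exact one_div_le_one_div_of_le (by positivity) (Real.sqrt_le_sqrt (by linarith))
    calc 2 / δ * (1 / s ^ 2) ≤ 2 / δ * (4 * ((1 + |s|) ^ (-(3 / 2) : ℝ) * (1 / √M))) := by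
          gcongr; linarith
      _ = _ := by field_simp; ring

/-- Substituting `t = u/√n`, the integrand tends to `e^(-u²/2)` by the central limit theorem for
characteristic functions, and `hb` supplies the dominating function `e^(-u²/4)`. The limit is half
the total Gaussian integral. -/
lemma tendsto_sqrt_mul_integral_fejer {ν : Measure ℝ} [IsProbabilityMeasure ν]
    (h0 : ∫ x, x ∂ν = 0) (h1 : ∫ x, x ^ 2 ∂ν = 1) {δ : ℝ} (hδ : 0 < δ)
    (hb : ∀ t, |t| ≤ δ → ‖charFun ν t‖ ≤ Real.exp (-t ^ 2 / 4))
    {ρ : ℕ → Measure ℝ} [∀ n, IsProbabilityMeasure (ρ n)]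
    (hρ : ∀ n t, charFun (ρ n) t = charFun ν t ^ n) :
    Tendsto (fun n : ℕ => √n * ∫ s, fejer δ s ∂(ρ n)) atTop (𝓝 (√(2 * Real.pi) / 2)) := by
  have hclt := fun t => ProbabilityTheory.tendsto_charFun_inv_sqrt_mul_pow (P := ν) (X := id)
    aemeasurable_id (by simpa using h0) (by simpa using h1) t
  simp only [Measure.map_id] at hclt
  have hsqrt : Tendsto (fun n : ℕ => √(n : ℝ)) atTop atTop :=
    Real.tendsto_sqrt_atTop.comp tendsto_natCast_atTop_atTop
  let F : ℕ → ℝ → ℝ := fun n => (Ioc 0 (√n * δ)).indicator fun u =>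
    (1 - (√n)⁻¹ * u / δ) * (charFun ν ((√n)⁻¹ * u) ^ n).re
  have hF : ∀ n : ℕ, 0 < n → √n * ∫ s, fejer δ s ∂(ρ n) = ∫ u in Ioi 0, F n u := by
    intro n hn
    have hn' : (0 : ℝ) < √n := Real.sqrt_pos.2 (by exact_mod_cast hn)
    have := integral_fejer_sub (ρ n) (δ := δ) 0
    simp only [sub_zero, mul_zero, Complex.ofReal_zero, neg_zero, zero_mul, Complex.exp_zero,
      one_mul, hρ] at this
    rw [this]
    have h2 := intervalIntegral.integral_comp_mul_left (a := 0) (b := √n * δ)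
      (fun t => (1 - t / δ) * (charFun ν t ^ n).re) (c := (√n)⁻¹) (by positivity)
    rw [mul_zero, inv_mul_cancel_left₀ hn'.ne', inv_inv, smul_eq_mul] at h2
    rw [← h2, intervalIntegral.integral_of_le (by positivity),
      setIntegral_indicator measurableSet_Ioc, inter_eq_right.2 Ioc_subset_Ioi_self]
  have hlim : ∫ u in Ioi (0 : ℝ), Real.exp (-(1 / 2) * u ^ 2) = √(2 * Real.pi) / 2 := by
    rw [integral_gaussian_Ioi]; congr 2; ring
  rw [← hlim]
  refine Tendsto.congr' (f₁ := fun n => ∫ u in Ioi 0, F n u)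
    ((eventually_gt_atTop 0).mono fun n hn => (hF n hn).symm) ?_
  refine tendsto_integral_of_dominated_convergence (fun u => Real.exp (-(1 / 4) * u ^ 2)) ?_
    (integrable_exp_neg_mul_sq (by norm_num)).integrableOn ?_ ?_
  · intro n
    have : Continuous (charFun ν) := continuous_charFun
    exact (Continuous.aestronglyMeasurable (by fun_prop)).indicator measurableSet_Ioc
  · intro n
    refine ae_of_all _ fun u => ?_
    by_cases hu : u ∈ Ioc 0 (√n * δ)
    · simp only [F, indicator_of_mem hu]
      have hn' : (0 : ℝ) < √n := by
        rcases (Real.sqrt_nonneg n).eq_or_lt with h | h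
        · rw [← h] at hu; simp at hu
        · exact h
      have hle : (√n)⁻¹ * u ≤ δ := by rw [inv_mul_le_iff₀ hn']; exact hu.2
      have h0' : 0 ≤ (√n)⁻¹ * u := mul_nonneg (by positivity) hu.1.le
      have h1' : (√n)⁻¹ * u / δ ≤ 1 := (div_le_one hδ).2 hle
      have h2' : 0 ≤ (√n)⁻¹ * u / δ := div_nonneg h0' hδ.le
      have h3' : |(charFun ν ((√n)⁻¹ * u) ^ n).re| ≤ Real.exp (-(1 / 4) * u ^ 2) := by
        refine (Complex.abs_re_le_norm _).trans ?_
        rw [norm_pow]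
        calc ‖charFun ν ((√n)⁻¹ * u)‖ ^ n ≤ Real.exp (-((√n)⁻¹ * u) ^ 2 / 4) ^ n := by
              gcongr
              exact hb _ (by rwa [abs_of_nonneg h0'])
          _ = _ := by
              rw [← Real.exp_nat_mul]
              congr 1
              have hsq : (n : ℝ) = √n ^ 2 := (Real.sq_sqrt (Nat.cast_nonneg n)).symm
              generalize √(n : ℝ) = q at *
              rw [hsq]
              field_simp
      rw [norm_mul, Real.norm_eq_abs, Real.norm_eq_abs, abs_of_nonneg (by linarith)]
      nlinarith [abs_nonneg (charFun ν ((√n)⁻¹ * u) ^ n).re]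
    · simp only [F, indicator_of_notMem hu, norm_zero]
      positivity
  · refine (ae_restrict_iff' measurableSet_Ioi).2 (ae_of_all _ fun u hu => ?_)
    have hev : ∀ᶠ n : ℕ in atTop, u ∈ Ioc 0 (√n * δ) := by
      filter_upwards [(hsqrt.atTop_mul_const hδ).eventually_ge_atTop u] with n hn
      exact ⟨hu, hn⟩
    have hinv : Tendsto (fun n : ℕ => (√(n : ℝ))⁻¹ * u / δ) atTop (𝓝 0) := by
      simpa using ((tendsto_inv_atTop_zero.comp hsqrt).mul_const u).div_const δ
    have hre := (Complex.continuous_re.tendsto _).comp (hclt u)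
    have := (hinv.const_sub 1).mul hre
    refine (this.congr' ?_).trans_eq ?_
    · filter_upwards [hev] with n hn
      simp only [F, indicator_of_mem hn, Function.comp]
    · congr 1
      have : (-(u : ℂ) ^ 2 / 2) = ((-(1 / 2) * u ^ 2 : ℝ) : ℂ) := by push_cast; ring
      rw [this, ← Complex.ofReal_exp, Complex.ofReal_re]; ring

/-- For the `n`-fold convolution powers `ρ n` of a centred law with unit variance, the integral of
a function with exponential decay is of order `1 / √n`. -/
theorem integral_isTheta_inv_sqrt {ν : Measure ℝ} [IsProbabilityMeasure ν]
    (h0 : ∫ x, x ∂ν = 0) (h1 : ∫ x, x ^ 2 ∂ν = 1)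
    {ρ : ℕ → Measure ℝ} [∀ n, IsProbabilityMeasure (ρ n)]
    (hρ : ∀ n t, charFun (ρ n) t = charFun ν t ^ n) {g : ℝ → ℝ} (hg : Measurable g) {a b : ℝ}
    (ha : 0 < a) (hb : 0 < b) (hga : ∀ s, g s ≤ Real.exp (-(a * |s|)))
    (hgb : ∀ s, Real.exp (-(b * |s|)) ≤ g s) :
    (fun n : ℕ => ∫ s, g s ∂(ρ n)) =Θ[atTop] fun n : ℕ => 1 / √(n : ℝ) := by
  obtain ⟨δ, hδ, hδ1, hφ⟩ := exists_norm_charFun_le_exp h0 h1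
  set J : ℝ := ∫ s : ℝ, (1 + |s|) ^ (-(3 / 2) : ℝ) with hJ
  have hJ0 : 0 ≤ J := integral_nonneg one_add_abs_rpow_nonneg
  set C : ℝ := 8 / δ * √Real.pi with hCdef
  have hC0 : 0 ≤ C := by positivity
  have hr : ∀ n : ℕ, 0 < n →
      ∫ s, (1 + |s|) ^ (-(3 / 2) : ℝ) ∂(ρ n) ≤ C * (4 * J) * (1 / √n) := by
    intro n hn
    have := integral_one_add_abs_rpow_le (ρ := ρ n) (B := C / √n) (by positivity)
      (fun a => measure_closedBall_le hδ hδ1 hφ hn (hρ n) a)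
    refine this.trans_eq ?_
    ring
  have hg0 : ∀ s, 0 ≤ g s := fun s => (Real.exp_pos _).le.trans (hgb s)
  have hgi : ∀ n, Integrable g (ρ n) := fun n =>
    (integrable_exp_neg_mul_abs ha (ρ n)).mono' hg.aestronglyMeasurable
      (ae_of_all _ fun s => by rw [Real.norm_eq_abs, abs_of_nonneg (hg0 s)]; exact hga s)
  have hgn : ∀ n, ‖∫ s, g s ∂(ρ n)‖ = ∫ s, g s ∂(ρ n) := fun n => by
    rw [Real.norm_eq_abs, abs_of_nonneg (integral_nonneg hg0)]
  have hqn : ∀ n : ℕ, ‖1 / √(n : ℝ)‖ = 1 / √(n : ℝ) := fun n => by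
    rw [Real.norm_eq_abs, abs_of_nonneg (by positivity)]
  constructor
  · refine IsBigO.of_bound ((2 + 4 / a ^ 2) * (C * (4 * J))) ?_
    filter_upwards [eventually_gt_atTop 0] with n hn
    rw [hgn, hqn]
    calc ∫ s, g s ∂(ρ n) ≤ ∫ s, (2 + 4 / a ^ 2) * (1 + |s|) ^ (-(3 / 2) : ℝ) ∂(ρ n) :=
          integral_mono (hgi n) ((integrable_one_add_abs_rpow' (ρ n)).const_mul _)
            fun s => (hga s).trans (exp_neg_mul_abs_le ha s)
      _ = (2 + 4 / a ^ 2) * ∫ s, (1 + |s|) ^ (-(3 / 2) : ℝ) ∂(ρ n) := integral_const_mul _ _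
      _ ≤ (2 + 4 / a ^ 2) * (C * (4 * J) * (1 / √n)) := by gcongr; exact hr n hn
      _ = _ := by ring
  -- `M` is taken so large that the tail of the Fejér kernel contributes at most half of the lower
  -- bound `1/√n`, uniformly in `n`.
  · obtain ⟨M, hM1, hM⟩ : ∃ M : ℝ, 1 ≤ M ∧ 8 / (δ * √M) * (C * (4 * J)) ≤ 1 / 2 := by
      have : Tendsto (fun M : ℝ => 8 / (δ * √M) * (C * (4 * J))) atTop (𝓝 (0 * (C * (4 * J)))) :=
        ((Real.tendsto_sqrt_atTop.const_mul_atTop hδ).const_div_atTop 8).mul_const _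
      rw [zero_mul] at this
      exact ((eventually_ge_atTop 1).and
        (this.eventually_le_const (show (0 : ℝ) < 1 / 2 by norm_num))).exists
    have hlim := tendsto_sqrt_mul_integral_fejer h0 h1 hδ hφ hρ
    have hone : 1 < √(2 * Real.pi) / 2 := by
      have : 2 < √(2 * Real.pi) := Real.lt_sqrt_of_sq_lt (by linarith [Real.pi_gt_three])
      linarith
    refine IsBigO.of_bound (2 * δ * Real.exp (b * M)) ?_
    filter_upwards [eventually_gt_atTop 0, hlim.eventually_const_lt hone] with n hn hfe
    have hn' : (0 : ℝ) < √n := Real.sqrt_pos.2 (by exact_mod_cast hn)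
    rw [hgn, hqn]
    have hfe' : 1 / √(n : ℝ) ≤ ∫ s, fejer δ s ∂(ρ n) := by
      rw [div_le_iff₀ hn', mul_comm]; exact hfe.le
    have hind : Integrable ((Icc (-M) M).indicator fun _ => δ) (ρ n) :=
      (integrable_const δ).indicator measurableSet_Icc
    have hup : ∫ s, fejer δ s ∂(ρ n)
        ≤ (ρ n).real (Icc (-M) M) * δ + 8 / (δ * √M) * (C * (4 * J) * (1 / √n)) := by
      have hri := (integrable_one_add_abs_rpow' (ρ n)).const_mul (8 / (δ * √M))
      calc ∫ s, fejer δ s ∂(ρ n)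
          ≤ ∫ s, ((Icc (-M) M).indicator (fun _ => δ) s
              + 8 / (δ * √M) * (1 + |s|) ^ (-(3 / 2) : ℝ)) ∂(ρ n) :=
            integral_mono (by simpa using integrable_fejer_sub hδ (ρ n) 0) (hind.add hri)
              fun s => fejer_le_indicator_add hδ hM1 s
        _ = (ρ n).real (Icc (-M) M) * δ
              + 8 / (δ * √M) * ∫ s, (1 + |s|) ^ (-(3 / 2) : ℝ) ∂(ρ n) := by
            rw [integral_add hind hri, integral_const_mul, integral_indicator_const _
              measurableSet_Icc, smul_eq_mul]
        _ ≤ _ := by gcongr; exact hr n hn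
    -- The kernel's expectation exceeds `1/√n` and its tail absorbs at most half, so the other half
    -- must come from mass in `[-M, M]`.
    have hmass : 1 / √(n : ℝ) ≤ 2 * δ * (ρ n).real (Icc (-M) M) := by
      have : 8 / (δ * √M) * (C * (4 * J) * (1 / √n)) ≤ 1 / 2 * (1 / √(n : ℝ)) := by
        rw [← mul_assoc]; gcongr
      linarith
    have hlow : (ρ n).real (Icc (-M) M) * Real.exp (-(b * M)) ≤ ∫ s, g s ∂(ρ n) := by
      rw [← smul_eq_mul, ← integral_indicator_const _ measurableSet_Icc]
      refine integral_mono ((integrable_const _).indicator measurableSet_Icc) (hgi n) fun s => ?_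
      by_cases hs : s ∈ Icc (-M) M
      · rw [indicator_of_mem hs]
        refine le_trans (Real.exp_le_exp.2 ?_) (hgb s)
        have := abs_le.2 hs
        nlinarith
      · rw [indicator_of_notMem hs]; exact hg0 s
    calc 1 / √(n : ℝ) ≤ 2 * δ * (ρ n).real (Icc (-M) M) := hmass
      _ = 2 * δ * Real.exp (b * M) * ((ρ n).real (Icc (-M) M) * Real.exp (-(b * M))) := by
          rw [Real.exp_neg]; field_simp
      _ ≤ _ := by gcongr

end LocalLimit

/-! ### Densities, the Chernoff coefficient and the Bayes error -/

section Densities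

variable {Ω : Type*} [MeasurableSpace Ω] {μ : Measure Ω}

lemma IsDensity.isProbabilityMeasure_law {f : Ω → ℝ} (hf : IsDensity μ f) :
    IsProbabilityMeasure (law μ f) :=
  ⟨by rw [law, withDensity_apply _ MeasurableSet.univ, setLIntegral_univ, hf.lintegral_eq_one]⟩

lemma IsDensity.integrable {f : Ω → ℝ} (hf : IsDensity μ f) : Integrable f μ := by
  refine ⟨hf.measurable.aestronglyMeasurable, ?_⟩
  rw [hasFiniteIntegral_iff_ofReal (ae_of_all _ hf.nonneg), hf.lintegral_eq_one]
  exact ENNReal.one_lt_top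

lemma IsDensity.integral_eq_one {f : Ω → ℝ} (hf : IsDensity μ f) : ∫ x, f x ∂μ = 1 := by
  rw [integral_eq_lintegral_of_nonneg_ae (ae_of_all _ hf.nonneg)
    hf.measurable.aestronglyMeasurable, hf.lintegral_eq_one, ENNReal.toReal_one]

lemma integral_law {f : Ω → ℝ} (hf : Measurable f) (h0 : ∀ x, 0 ≤ f x) (g : Ω → ℝ) :
    ∫ x, g x ∂(law μ f) = ∫ x, f x * g x ∂μ := by
  rw [law, integral_withDensity_eq_integral_toReal_smul (by fun_prop) (by simp)]
  simp [ENNReal.toReal_ofReal (h0 _)]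

lemma integrable_law_iff {f : Ω → ℝ} (hf : Measurable f) (h0 : ∀ x, 0 ≤ f x) (g : Ω → ℝ) :
    Integrable g (law μ f) ↔ Integrable (fun x => f x * g x) μ := by
  rw [law, integrable_withDensity_iff_integrable_smul' (by fun_prop) (by simp)]
  simp [ENNReal.toReal_ofReal (h0 _)]

lemma ae_eq_zero_of_law_absolutelyContinuous {f g : Ω → ℝ} (hf : IsDensity μ f)
    (hg : IsDensity μ g) (h : law μ f ≪ law μ g) : ∀ᵐ x ∂μ, g x = 0 → f x = 0 := by
  have hs : MeasurableSet {x | g x = 0} := hg.measurable (measurableSet_singleton 0)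
  have h1 : law μ g {x | g x = 0} = 0 := by
    rw [law, withDensity_apply _ hs, setLIntegral_congr_fun hs (g := fun _ => 0)
      (fun x hx => by simp only [mem_ofPred_eq] at hx; simp [hx]), lintegral_zero]
  have h2 := h h1
  rw [law, withDensity_apply _ hs, lintegral_eq_zero_iff (by have := hf.measurable; fun_prop),
    EventuallyEq, ae_restrict_iff' hs] at h2
  filter_upwards [h2] with x hx hgx
  have := hx hgx
  simp only [Pi.zero_apply, ENNReal.ofReal_eq_zero] at this
  exact le_antisymm this (hf.nonneg x)

variable {φ : Fin 2 → Ω → ℝ}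

/-- Finite divergence in each direction forces mutual absolute continuity. -/
lemma IsAdmissible.ae_eq_zero_iff (hφ : IsAdmissible μ φ) : ∀ᵐ x ∂μ, φ 0 x = 0 ↔ φ 1 x = 0 := by
  have h1 := (InformationTheory.klDiv_ne_top_iff.1 hφ.kl_lt_top.ne).1
  have h2 := (InformationTheory.klDiv_ne_top_iff.1 hφ.kl_lt_top'.ne).1
  filter_upwards [ae_eq_zero_of_law_absolutelyContinuous (hφ.isDensity 0) (hφ.isDensity 1) h1,
    ae_eq_zero_of_law_absolutelyContinuous (hφ.isDensity 1) (hφ.isDensity 0) h2] with x h h'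
  exact ⟨h', h⟩

lemma IsAdmissible.not_ae_eq (hφ : IsAdmissible μ φ) : ¬ φ 0 =ᵐ[μ] φ 1 := by
  intro h
  have : law μ (φ 0) = law μ (φ 1) := withDensity_congr_ae (h.mono fun x hx => by simp only [hx])
  have := (hφ.isDensity 1).isProbabilityMeasure_law
  have h' := hφ.kl_pos
  rw [‹law μ (φ 0) = _›, InformationTheory.klDiv_self] at h'
  exact lt_irrefl _ h'

/-- The Chernoff coefficient `∫ φ₀^(1-α) φ₁^α dμ`. -/
noncomputable def chernoffCoeff (μ : Measure Ω) (φ : Fin 2 → Ω → ℝ) (α : ℝ) : ℝ :=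
  ∫ x, φ 0 x ^ (1 - α) * φ 1 x ^ α ∂μ

lemma measurable_rpow_mul_rpow (hφ : ∀ z, IsDensity μ (φ z)) (α : ℝ) :
    Measurable fun x => φ 0 x ^ (1 - α) * φ 1 x ^ α :=
  ((hφ 0).measurable.pow_const _).mul ((hφ 1).measurable.pow_const _)

lemma rpow_mul_rpow_nonneg (hφ : ∀ z, IsDensity μ (φ z)) (α : ℝ) (x : Ω) :
    0 ≤ φ 0 x ^ (1 - α) * φ 1 x ^ α :=
  mul_nonneg (Real.rpow_nonneg ((hφ 0).nonneg x) _) (Real.rpow_nonneg ((hφ 1).nonneg x) _)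

lemma norm_rpow_mul_rpow_le (hφ : ∀ z, IsDensity μ (φ z)) {α : ℝ} (hα : α ∈ Icc (0 : ℝ) 1) (x : Ω) :
    ‖φ 0 x ^ (1 - α) * φ 1 x ^ α‖ ≤ φ 0 x + φ 1 x := by
  have h0 := (hφ 0).nonneg x
  have h1 := (hφ 1).nonneg x
  rw [Real.norm_eq_abs, abs_of_nonneg (rpow_mul_rpow_nonneg hφ α x)]
  have := Real.geom_mean_le_arith_mean2_weighted (sub_nonneg.2 hα.2) hα.1 h0 h1 (by ring)
  nlinarith [hα.1, hα.2]

lemma integrable_rpow_mul_rpow (hφ : ∀ z, IsDensity μ (φ z)) {α : ℝ} (hα : α ∈ Icc (0 : ℝ) 1) :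
    Integrable (fun x => φ 0 x ^ (1 - α) * φ 1 x ^ α) μ :=
  ((hφ 0).integrable.add (hφ 1).integrable).mono'
    (measurable_rpow_mul_rpow hφ α).aestronglyMeasurable
    (ae_of_all _ fun x => norm_rpow_mul_rpow_le hφ hα x)

lemma chernoffCoeff_zero (hφ : IsAdmissible μ φ) : chernoffCoeff μ φ 0 = 1 := by
  simpa [chernoffCoeff] using (hφ.isDensity 0).integral_eq_one

lemma chernoffCoeff_one (hφ : IsAdmissible μ φ) : chernoffCoeff μ φ 1 = 1 := by
  simpa [chernoffCoeff] using (hφ.isDensity 1).integral_eq_one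

lemma zero_rpow_mul_zero_rpow (α : ℝ) : (0 : ℝ) ^ (1 - α) * 0 ^ α = 0 := by
  rcases eq_or_ne α 0 with rfl | h
  · simp
  · rw [Real.zero_rpow h, mul_zero]

/-- Dominated convergence with bound `φ₀ + φ₁`. Continuity at the endpoints needs the common zero
set: where only one density vanished, the convention `0^0 = 1` would make the integrand jump. -/
lemma continuousOn_chernoffCoeff (hφ : IsAdmissible μ φ) :
    ContinuousOn (chernoffCoeff μ φ) (Icc 0 1) := by
  refine continuousOn_of_dominated (bound := fun x => φ 0 x + φ 1 x)
    (fun α _ => (measurable_rpow_mul_rpow hφ.isDensity α).aestronglyMeasurable)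
    (fun α hα => ae_of_all _ fun x => norm_rpow_mul_rpow_le hφ.isDensity hα x)
    ((hφ.isDensity 0).integrable.add (hφ.isDensity 1).integrable) ?_
  filter_upwards [hφ.ae_eq_zero_iff] with x hx
  by_cases h0 : φ 0 x = 0
  · simp only [h0, hx.1 h0, zero_rpow_mul_zero_rpow]
    exact continuousOn_const
  · have h1 : φ 1 x ≠ 0 := fun h => h0 (hx.2 h)
    refine Continuous.continuousOn ?_
    exact (Real.continuous_const_rpow h0).comp (continuous_const.sub continuous_id) |>.mul
      (Real.continuous_const_rpow h1)

/-- The squared Hellinger distance `∫ (√φ₀ - √φ₁)²` equals `2 - 2 Z(1/2)`, and it is positive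
because the densities differ. -/
lemma chernoffCoeff_half_lt_one (hφ : IsAdmissible μ φ) : chernoffCoeff μ φ (1 / 2) < 1 := by
  have hi0 := (hφ.isDensity 0).integrable
  have hi1 := (hφ.isDensity 1).integrable
  have hih := integrable_rpow_mul_rpow hφ.isDensity (α := 1 / 2) ⟨by norm_num, by norm_num⟩
  have heq : ∀ x, (√(φ 0 x) - √(φ 1 x)) ^ 2
      = φ 0 x + φ 1 x - 2 * (φ 0 x ^ (1 - 1 / 2 : ℝ) * φ 1 x ^ (1 / 2 : ℝ)) := by
    intro x
    rw [show (1 - 1 / 2 : ℝ) = 1 / 2 by norm_num, ← Real.sqrt_eq_rpow, ← Real.sqrt_eq_rpow, sub_sq,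
      Real.sq_sqrt ((hφ.isDensity 0).nonneg x), Real.sq_sqrt ((hφ.isDensity 1).nonneg x)]
    ring
  have hint : Integrable (fun x => (√(φ 0 x) - √(φ 1 x)) ^ 2) μ := by
    simp only [heq]
    exact (hi0.add hi1).sub (hih.const_mul 2)
  have hval : ∫ x, (√(φ 0 x) - √(φ 1 x)) ^ 2 ∂μ = 2 - 2 * chernoffCoeff μ φ (1 / 2) := by
    simp only [heq]
    have hadd : Integrable (fun x => φ 0 x + φ 1 x) μ := hi0.add hi1
    rw [integral_sub hadd (hih.const_mul 2), integral_add hi0 hi1, integral_const_mul,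
      (hφ.isDensity 0).integral_eq_one, (hφ.isDensity 1).integral_eq_one, chernoffCoeff]
    norm_num
  have hpos : 0 < ∫ x, (√(φ 0 x) - √(φ 1 x)) ^ 2 ∂μ := by
    refine lt_of_le_of_ne (integral_nonneg fun x => sq_nonneg _) fun h => hφ.not_ae_eq ?_
    have := (integral_eq_zero_iff_of_nonneg (fun x => sq_nonneg _) hint).1 h.symm
    filter_upwards [this] with x hx
    have hx' : √(φ 0 x) = √(φ 1 x) := by
      simp only [Pi.zero_apply] at hx
      exact sub_eq_zero.1 (pow_eq_zero_iff (two_ne_zero) |>.1 hx)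
    exact (Real.sqrt_inj ((hφ.isDensity 0).nonneg x) ((hφ.isDensity 1).nonneg x)).1 hx'
  linarith

/-- Otherwise one density vanishes at almost every point, hence both do, and they would agree almost
everywhere. -/
lemma chernoffCoeff_pos (hφ : IsAdmissible μ φ) {α : ℝ} (hα : α ∈ Ioo (0 : ℝ) 1) :
    0 < chernoffCoeff μ φ α := by
  refine lt_of_le_of_ne (integral_nonneg fun x => rpow_mul_rpow_nonneg hφ.isDensity α x) fun h => ?_
  have h' := (integral_eq_zero_iff_of_nonneg (rpow_mul_rpow_nonneg hφ.isDensity α)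
    (integrable_rpow_mul_rpow hφ.isDensity (Ioo_subset_Icc_self hα))).1 h.symm
  have : φ 0 =ᵐ[μ] φ 1 := by
    filter_upwards [h', hφ.ae_eq_zero_iff] with x hx hiff
    rcases mul_eq_zero.1 hx with h0 | h1
    · have := (Real.rpow_eq_zero ((hφ.isDensity 0).nonneg x) (by linarith [hα.2])).1 h0
      rw [this, hiff.1 this]
    · have := (Real.rpow_eq_zero ((hφ.isDensity 1).nonneg x) hα.1.ne').1 h1
      rw [this, hiff.2 this]
  exact hφ.not_ae_eq this

/-- The endpoint values are `1` and the value at `1/2` is smaller, so the minimum over the compact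
interval is attained inside. -/
lemma exists_isMinOn_chernoffCoeff (hφ : IsAdmissible μ φ) :
    ∃ α ∈ Ioo (0 : ℝ) 1, IsMinOn (chernoffCoeff μ φ) (Icc 0 1) α := by
  obtain ⟨α, hα, hmin⟩ := isCompact_Icc.exists_isMinOn (nonempty_Icc.2 zero_le_one)
    (continuousOn_chernoffCoeff hφ)
  have hlt : chernoffCoeff μ φ α < 1 :=
    (hmin (show (1 / 2 : ℝ) ∈ Icc (0 : ℝ) 1 from ⟨by norm_num, by norm_num⟩)).trans_lt
      (chernoffCoeff_half_lt_one hφ)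
  refine ⟨α, ⟨hα.1.lt_of_ne ?_, hα.2.lt_of_ne ?_⟩, hmin⟩
  · rintro rfl
    rw [chernoffCoeff_zero hφ] at hlt; exact lt_irrefl _ hlt
  · rintro rfl
    rw [chernoffCoeff_one hφ] at hlt; exact lt_irrefl _ hlt

lemma chernoffInfo_eq (hφ : IsAdmissible μ φ) {α : ℝ} (hα : α ∈ Ioo (0 : ℝ) 1)
    (hmin : IsMinOn (chernoffCoeff μ φ) (Icc 0 1) α) :
    chernoffInfo μ φ = -Real.log (chernoffCoeff μ φ α) := by
  have hle : ∀ β : Ioo (0 : ℝ) 1, chernoffDiv μ φ β ≤ -Real.log (chernoffCoeff μ φ α) := fun β =>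
    neg_le_neg (Real.log_le_log (chernoffCoeff_pos hφ hα) (hmin (Ioo_subset_Icc_self β.2)))
  have : Nonempty (Ioo (0 : ℝ) 1) := ⟨⟨α, hα⟩⟩
  refine le_antisymm (ciSup_le hle) ?_
  exact le_ciSup (f := fun β : Ioo (0 : ℝ) 1 => chernoffDiv μ φ β)
    ⟨_, forall_mem_range.2 hle⟩ ⟨α, hα⟩

lemma affinity_nonneg (hφ : ∀ z x, 0 ≤ φ z x) : 0 ≤ affinity μ φ :=
  integral_nonneg fun x => le_min (hφ 0 x) (hφ 1 x)

/-- The Bayes error probability is half the total variation affinity. -/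
lemma errorProb_eq_affinity (hm : ∀ z, Measurable (φ z)) (h0 : ∀ z x, 0 ≤ φ z x)
    (hi : Integrable (φ 0) μ) {zhat : Ω → Fin 2} (hz : IsBayesEstimator φ zhat) :
    errorProb μ φ zhat = 1 / 2 * affinity μ φ := by
  have hs : ∀ z, MeasurableSet {x | zhat x ≠ z} := fun z =>
    (hz.1 (measurableSet_singleton z)).compl
  have hmin : Integrable (fun x => min (φ 0 x) (φ 1 x)) μ :=
    hi.mono' ((hm 0).min (hm 1)).aestronglyMeasurable (ae_of_all _ fun x => by
      rw [Real.norm_eq_abs, abs_of_nonneg (le_min (h0 0 x) (h0 1 x))]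
      exact min_le_left _ _)
  -- Where the estimator misses `z`, it chose the other index, so `φ z` is the smaller density.
  have key : ∀ z, (law μ (φ z)).real {x | zhat x ≠ z}
      = ∫ x in {x | zhat x ≠ z}, min (φ 0 x) (φ 1 x) ∂μ := by
    intro z
    rw [measureReal_def, law, withDensity_apply _ (hs z), integral_eq_lintegral_of_nonneg_ae
      (ae_of_all _ fun x => le_min (h0 0 x) (h0 1 x))
      ((hm 0).min (hm 1)).aestronglyMeasurable]
    congr 1
    refine setLIntegral_congr_fun (hs z) fun x hx => ?_
    have h1 := hz.2 x 0
    have h2 := hz.2 x 1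
    simp only [mem_ofPred_eq] at hx
    generalize zhat x = w at *
    congr 1
    fin_cases z <;> fin_cases w <;> simp_all
  rw [errorProb, Fin.sum_univ_two, key, key, affinity]
  congr 1
  have hc : {x | zhat x ≠ 1} = {x | zhat x ≠ 0}ᶜ := by
    ext x
    simp only [mem_ofPred_eq, mem_compl_iff, not_not]
    generalize zhat x = w
    fin_cases w <;> simp
  rw [hc]
  exact integral_add_compl (hs 0) hmin

lemma measurable_iidDensity {f : Ω → ℝ} (hf : Measurable f) (n : ℕ) :
    Measurable (iidDensity n f) :=
  Finset.measurable_fun_prod _ fun j _ => hf.comp (measurable_pi_apply j)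

lemma iidDensity_nonneg {α : Type*} {f : α → ℝ} (hf : ∀ x, 0 ≤ f x) (n : ℕ) (x : Fin n → α) :
    0 ≤ iidDensity n f x :=
  Finset.prod_nonneg fun j _ => hf (x j)

lemma integrable_iidDensity [SigmaFinite μ] {f : Ω → ℝ} (hf : Integrable f μ) (n : ℕ) :
    Integrable (iidDensity n f) (Measure.pi fun _ : Fin n => μ) :=
  Integrable.fintype_prod fun _ => hf

/-- The product of the laws has the product density. -/
lemma pi_law [SigmaFinite μ] {f : Ω → ℝ} (hf : IsDensity μ f) (n : ℕ) :
    Measure.pi (fun _ : Fin n => law μ f) = law (Measure.pi fun _ : Fin n => μ) (iidDensity n f) := by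
  have := hf.isProbabilityMeasure_law
  refine Measure.pi_eq fun s hs => ?_
  -- Masses are written as real integrals of indicators so that Fubini for finite products applies.
  have hreal : ∀ j, law μ f (s j) = ENNReal.ofReal (∫ x, (s j).indicator f x ∂μ) := fun j => by
    rw [law, withDensity_apply _ (hs j), integral_indicator (hs j),
      ofReal_integral_eq_lintegral_ofReal hf.integrable.integrableOn (ae_of_all _ hf.nonneg)]
  have hms : MeasurableSet (univ.pi s) := MeasurableSet.univ_pi hs
  have h0 : ∀ j, 0 ≤ ∫ x, (s j).indicator f x ∂μ := fun j =>
    integral_nonneg (indicator_nonneg fun x _ => hf.nonneg x)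
  simp only [hreal]
  rw [← ENNReal.ofReal_prod_of_nonneg (fun j _ => h0 j),
    ← integral_fintype_prod_eq_prod (fun j => (s j).indicator f), law, withDensity_apply _ hms,
    ← ofReal_integral_eq_lintegral_ofReal (integrable_iidDensity hf.integrable n).integrableOn
      (ae_of_all _ (iidDensity_nonneg hf.nonneg n)), ← integral_indicator hms]
  congr 2
  ext x
  by_cases hx : x ∈ univ.pi s
  · rw [indicator_of_mem hx]
    exact Finset.prod_congr rfl fun j _ => (indicator_of_mem (hx j trivial) f).symm
  · rw [indicator_of_notMem hx]
    simp only [Set.mem_pi, not_forall] at hx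
    obtain ⟨j, _, hj⟩ := hx
    exact (Finset.prod_eq_zero (Finset.mem_univ j) (indicator_of_notMem hj f)).symm

end Densities

/-! ### Exponential tilting at the Chernoff point -/

section Tilting

variable {Ω : Type*} [MeasurableSpace Ω] {μ : Measure Ω} {φ : Fin 2 → Ω → ℝ}

/-- The log-likelihood ratio `log (φ₁ / φ₀)`. -/
noncomputable def logRatio (φ : Fin 2 → Ω → ℝ) (x : Ω) : ℝ := Real.log (φ 1 x) - Real.log (φ 0 x)

lemma measurable_logRatio (hφ : ∀ z, IsDensity μ (φ z)) : Measurable (logRatio φ) :=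
  (hφ 1).measurable.log.sub (hφ 0).measurable.log

/-- On the common zero set both sides vanish, so the default value `log 0 = 0` does no harm. -/
lemma ae_mul_exp_logRatio (hφ : IsAdmissible μ φ) :
    ∀ᵐ x ∂μ, ∀ α : ℝ, φ 0 x * Real.exp (α * logRatio φ x) = φ 0 x ^ (1 - α) * φ 1 x ^ α := by
  filter_upwards [hφ.ae_eq_zero_iff] with x hx α
  rcases ((hφ.isDensity 0).nonneg x).eq_or_lt with h0 | h0
  · rw [← h0, hx.1 h0.symm, zero_mul, zero_rpow_mul_zero_rpow]
  · have h1 : 0 < φ 1 x :=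
      ((hφ.isDensity 1).nonneg x).lt_of_ne fun h => h0.ne' (hx.2 h.symm)
    rw [Real.rpow_def_of_pos h0, Real.rpow_def_of_pos h1, ← Real.exp_add]
    nth_rw 1 [← Real.exp_log h0]
    rw [← Real.exp_add, logRatio]
    congr 1
    ring

lemma mgf_logRatio (hφ : IsAdmissible μ φ) (α : ℝ) :
    ProbabilityTheory.mgf (logRatio φ) (law μ (φ 0)) α = chernoffCoeff μ φ α := by
  rw [ProbabilityTheory.mgf, integral_law (hφ.isDensity 0).measurable (hφ.isDensity 0).nonneg,
    chernoffCoeff]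
  exact integral_congr_ae ((ae_mul_exp_logRatio hφ).mono fun x hx => hx α)

lemma integrable_exp_mul_logRatio (hφ : IsAdmissible μ φ) {α : ℝ} (hα : α ∈ Icc (0 : ℝ) 1) :
    Integrable (fun x => Real.exp (α * logRatio φ x)) (law μ (φ 0)) := by
  rw [integrable_law_iff (hφ.isDensity 0).measurable (hφ.isDensity 0).nonneg]
  exact (integrable_rpow_mul_rpow hφ.isDensity hα).congr
    ((ae_mul_exp_logRatio hφ).mono fun x hx => (hx α).symm)

/-- Interior points give differentiability of the moment generating function and finite moments
under the tilted law. -/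
lemma mem_interior_integrableExpSet (hφ : IsAdmissible μ φ) {α : ℝ} (hα : α ∈ Ioo (0 : ℝ) 1) :
    α ∈ interior (ProbabilityTheory.integrableExpSet (logRatio φ) (law μ (φ 0))) :=
  interior_maximal (fun _ hβ => integrable_exp_mul_logRatio hφ (Ioo_subset_Icc_self hβ)) isOpen_Ioo hα

/-- The density `φ₀^(1-α) φ₁^α / ∫ φ₀^(1-α) φ₁^α dμ` of the geometric mixture. -/
noncomputable def tiltedDensity (μ : Measure Ω) (φ : Fin 2 → Ω → ℝ) (α : ℝ) (x : Ω) : ℝ :=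
  φ 0 x * (Real.exp (α * logRatio φ x) / chernoffCoeff μ φ α)

lemma law_tiltedDensity (hφ : IsAdmissible μ φ) (α : ℝ) :
    law μ (tiltedDensity μ φ α) = (law μ (φ 0)).tilted (fun x => α * logRatio φ x) := by
  have hX := measurable_logRatio hφ.isDensity
  have hm := (hφ.isDensity 0).measurable
  have hZ : ∫ x, Real.exp (α * logRatio φ x) ∂(law μ (φ 0)) = chernoffCoeff μ φ α :=
    mgf_logRatio hφ α
  rw [Measure.tilted, hZ]
  unfold law
  rw [← withDensity_mul _ (by fun_prop) (by fun_prop)]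
  congr 1
  ext x
  rw [tiltedDensity, ENNReal.ofReal_mul ((hφ.isDensity 0).nonneg x)]
  rfl

lemma isDensity_tiltedDensity (hφ : IsAdmissible μ φ) {α : ℝ} (hα : α ∈ Ioo (0 : ℝ) 1) :
    IsDensity μ (tiltedDensity μ φ α) where
  measurable := by
    have hX := measurable_logRatio hφ.isDensity
    have hm := (hφ.isDensity 0).measurable
    unfold tiltedDensity
    fun_prop
  nonneg x := mul_nonneg ((hφ.isDensity 0).nonneg x)
    (div_nonneg (Real.exp_pos _).le (chernoffCoeff_pos hφ hα).le)
  lintegral_eq_one := by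
    have := (hφ.isDensity 0).isProbabilityMeasure_law
    have := isProbabilityMeasure_tilted (integrable_exp_mul_logRatio hφ (Ioo_subset_Icc_self hα))
    rw [← law_tiltedDensity hφ] at this
    have h := this.measure_univ
    rwa [law, withDensity_apply _ MeasurableSet.univ, setLIntegral_univ] at h

/-- The tilted mean is the logarithmic derivative of the moment generating function, which vanishes
at an interior minimum. -/
lemma integral_logRatio_tilted (hφ : IsAdmissible μ φ) {α : ℝ} (hα : α ∈ Ioo (0 : ℝ) 1)
    (hmin : IsMinOn (chernoffCoeff μ φ) (Icc 0 1) α) :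
    ∫ x, logRatio φ x ∂(law μ (tiltedDensity μ φ α)) = 0 := by
  have hint := mem_interior_integrableExpSet hφ hα
  rw [law_tiltedDensity hφ, ProbabilityTheory.integral_tilted_mul_self hint,
    ProbabilityTheory.deriv_cgf hint, ← ProbabilityTheory.deriv_mgf hint]
  have hloc : IsLocalMin (ProbabilityTheory.mgf (logRatio φ) (law μ (φ 0))) α := by
    rw [show ProbabilityTheory.mgf (logRatio φ) (law μ (φ 0)) = chernoffCoeff μ φ from
      funext (mgf_logRatio hφ)]
    exact hmin.isLocalMin (Icc_mem_nhds hα.1 hα.2)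
  rw [hloc.deriv_eq_zero, zero_div]

/-- A zero second moment would give `φ₁ = φ₀` wherever `φ₀ > 0`, and then almost everywhere. -/
lemma integral_logRatio_sq_tilted_pos (hφ : IsAdmissible μ φ) {α : ℝ} (hα : α ∈ Ioo (0 : ℝ) 1) :
    0 < ∫ x, logRatio φ x ^ 2 ∂(law μ (tiltedDensity μ φ α)) := by
  have hint := mem_interior_integrableExpSet hφ hα
  have hL : MemLp (logRatio φ) 2 (law μ (tiltedDensity μ φ α)) := by
    rw [law_tiltedDensity hφ]
    exact ProbabilityTheory.memLp_tilted_mul hint 2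
  refine lt_of_le_of_ne (integral_nonneg fun x => sq_nonneg _) fun h => hφ.not_ae_eq ?_
  have h1 := (integral_eq_zero_iff_of_nonneg (fun x => sq_nonneg _) hL.integrable_sq).1 h.symm
  rw [law_tiltedDensity hφ] at h1
  have h2 := (absolutelyContinuous_tilted
    (integrable_exp_mul_logRatio hφ (Ioo_subset_Icc_self hα))).ae_eq h1
  rw [EventuallyEq, law, ae_withDensity_iff (by have := (hφ.isDensity 0).measurable; fun_prop)] at h2
  filter_upwards [h2, hφ.ae_eq_zero_iff] with x hx hiff
  rcases ((hφ.isDensity 0).nonneg x).eq_or_lt with h0 | h0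
  · rw [← h0, hiff.1 h0.symm]
  · have hpos : 0 < φ 1 x :=
      ((hφ.isDensity 1).nonneg x).lt_of_ne fun h => h0.ne' (hiff.2 h.symm)
    have := hx (by simpa using h0)
    simp only [Pi.zero_apply, ne_eq, OfNat.ofNat_ne_zero, not_false_eq_true, pow_eq_zero_iff,
      logRatio] at this
    exact (Real.log_injOn_pos hpos h0 (sub_eq_zero.1 this)).symm

lemma eq_mul_tiltedDensity_zero (hφ : IsAdmissible μ φ) {α : ℝ} (hα : α ∈ Ioo (0 : ℝ) 1) (x : Ω) :
    φ 0 x = chernoffCoeff μ φ α * tiltedDensity μ φ α x * Real.exp (-(α * logRatio φ x)) := by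
  have := (chernoffCoeff_pos hφ hα).ne'
  rw [tiltedDensity, Real.exp_neg]
  field_simp

lemma ae_eq_mul_tiltedDensity_one (hφ : IsAdmissible μ φ) {α : ℝ} (hα : α ∈ Ioo (0 : ℝ) 1) :
    ∀ᵐ x ∂μ, φ 1 x
      = chernoffCoeff μ φ α * tiltedDensity μ φ α x * Real.exp ((1 - α) * logRatio φ x) := by
  filter_upwards [ae_mul_exp_logRatio hφ] with x hx
  have h1 := hx 1
  rw [sub_self, Real.rpow_zero, one_mul, one_mul, Real.rpow_one] at h1
  have := (chernoffCoeff_pos hφ hα).ne'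
  rw [← h1, tiltedDensity, sub_mul, one_mul, Real.exp_sub]
  field_simp

lemma iidDensity_eq_of_forall {β : Type*} {f q X : β → ℝ} {Z c : ℝ} {n : ℕ} {x : Fin n → β}
    (h : ∀ j, f (x j) = Z * q (x j) * Real.exp (c * X (x j))) :
    iidDensity n f x = iidDensity n q x * (Z ^ n * Real.exp (c * ∑ j, X (x j))) := by
  simp only [iidDensity, h, Finset.prod_mul_distrib, Finset.prod_const, Finset.card_univ,
    Fintype.card_fin, Finset.mul_sum, Real.exp_sum]
  ring

/-- With `q` the tilted density, `φ₀ = Z q e^(-αX)` and `φ₁ = Z q e^((1-α)X)`; taking products, the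
common factor `Z^n ∏ q` leaves the minimum. -/
lemma affinity_eq [SigmaFinite μ] (hφ : IsAdmissible μ φ) {α : ℝ} (hα : α ∈ Ioo (0 : ℝ) 1) (n : ℕ) :
    affinity (Measure.pi fun _ : Fin n => μ) (fun z => iidDensity n (φ z))
      = chernoffCoeff μ φ α ^ n * ∫ x, min (Real.exp (-α * ∑ j, logRatio φ (x j)))
          (Real.exp ((1 - α) * ∑ j, logRatio φ (x j)))
          ∂(Measure.pi fun _ : Fin n => law μ (tiltedDensity μ φ α)) := by
  have hq := isDensity_tiltedDensity hφ hα
  rw [pi_law hq, integral_law (measurable_iidDensity hq.measurable n)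
    (iidDensity_nonneg hq.nonneg n), ← integral_const_mul, affinity]
  refine integral_congr_ae ?_
  have hae : ∀ᵐ x ∂(Measure.pi fun _ : Fin n => μ), ∀ j, φ 1 (x j) = chernoffCoeff μ φ α
      * tiltedDensity μ φ α (x j) * Real.exp ((1 - α) * logRatio φ (x j)) :=
    ae_all_iff.2 fun j => (Measure.tendsto_eval_ae_ae (μ := fun _ : Fin n => μ) (i := j)).eventually
      (ae_eq_mul_tiltedDensity_one hφ hα)
  filter_upwards [hae] with x hx
  have h0 := iidDensity_eq_of_forall (f := φ 0) (q := tiltedDensity μ φ α) (X := logRatio φ)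
    (Z := chernoffCoeff μ φ α) (c := -α) (x := x) fun j => by
      simpa using eq_mul_tiltedDensity_zero hφ hα (x j)
  have h1 := iidDensity_eq_of_forall (f := φ 1) (q := tiltedDensity μ φ α) (X := logRatio φ)
    (c := 1 - α) (x := x) hx
  have hn1 := iidDensity_nonneg hq.nonneg n x
  have hn2 : 0 ≤ chernoffCoeff μ φ α ^ n := pow_nonneg (chernoffCoeff_pos hφ hα).le n
  rw [h0, h1, ← mul_min_of_nonneg _ _ hn1, ← mul_min_of_nonneg _ _ hn2]
  ring

lemma charFun_map_sum_pi {Q : Measure Ω} [IsProbabilityMeasure Q] {Y : Ω → ℝ} (hY : Measurable Y)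
    (n : ℕ) (t : ℝ) :
    charFun ((Measure.pi fun _ : Fin n => Q).map fun x => ∑ j, Y (x j)) t
      = charFun (Q.map Y) t ^ n := by
  have hS : Measurable fun x : Fin n → Ω => ∑ j, Y (x j) := by fun_prop
  rw [charFun_apply_real, charFun_apply_real,
    integral_map hS.aemeasurable (Continuous.aestronglyMeasurable (by fun_prop)),
    integral_map hY.aemeasurable (Continuous.aestronglyMeasurable (by fun_prop))]
  have := integral_fintype_prod_eq_pow (ι := Fin n) (μ := Q)
    (fun x => Complex.exp (t * Y x * Complex.I))
  rw [Fintype.card_fin] at this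
  rw [← this]
  congr 1
  ext x
  rw [← Complex.exp_sum]
  congr 1
  push_cast
  rw [Finset.mul_sum, Finset.sum_mul]

/-- On each half-line, keep the exponential that decays there. -/
lemma min_exp_le {α : ℝ} {σ : ℝ} (hσ : 0 < σ) (s : ℝ) :
    min (Real.exp (-α * (σ * s))) (Real.exp ((1 - α) * (σ * s)))
      ≤ Real.exp (-(min α (1 - α) * σ * |s|)) := by
  rcases le_total 0 s with hs | hs
  · refine (min_le_left _ _).trans (Real.exp_le_exp.2 ?_)
    rw [abs_of_nonneg hs]
    have := mul_le_mul_of_nonneg_right (min_le_left α (1 - α)) (mul_nonneg hσ.le hs)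
    linarith
  · refine (min_le_right _ _).trans (Real.exp_le_exp.2 ?_)
    rw [abs_of_nonpos hs]
    have := mul_le_mul_of_nonneg_right (min_le_right α (1 - α))
      (mul_nonneg hσ.le (neg_nonneg.2 hs))
    linarith

lemma exp_le_min_exp {α : ℝ} (hα : α ∈ Ioo (0 : ℝ) 1) {σ : ℝ} (hσ : 0 < σ) (s : ℝ) :
    Real.exp (-(σ * |s|)) ≤ min (Real.exp (-α * (σ * s))) (Real.exp ((1 - α) * (σ * s))) := by
  have h1 : |σ * s| = σ * |s| := by rw [abs_mul, abs_of_pos hσ]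
  have h2 := neg_abs_le (σ * s)
  have h3 := le_abs_self (σ * s)
  have h4 := abs_nonneg (σ * s)
  rw [← h1]
  refine le_min (Real.exp_le_exp.2 ?_) (Real.exp_le_exp.2 ?_) <;> nlinarith [hα.1, hα.2]

/-- Sharp asymptotics of the total variation affinity of product densities. -/
theorem affinity_isTheta [SigmaFinite μ] (hφ : IsAdmissible μ φ) :
    (fun n : ℕ => affinity (Measure.pi fun _ : Fin n => μ) (fun z => iidDensity n (φ z)))
      =Θ[atTop] fun n : ℕ => 1 / √(n : ℝ) * Real.exp (-(n * chernoffInfo μ φ)) := by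
  obtain ⟨α, hα, hmin⟩ := exists_isMinOn_chernoffCoeff hφ
  have hq := isDensity_tiltedDensity hφ hα
  have hXm := measurable_logRatio hφ.isDensity
  set Q := law μ (tiltedDensity μ φ α) with hQ
  have : IsProbabilityMeasure Q := hq.isProbabilityMeasure_law
  have hv := integral_logRatio_sq_tilted_pos hφ hα
  set σ : ℝ := √(∫ x, logRatio φ x ^ 2 ∂Q) with hσdef
  have hσ : 0 < σ := Real.sqrt_pos.2 hv
  have hσ2 : σ ^ 2 = ∫ x, logRatio φ x ^ 2 ∂Q := Real.sq_sqrt hv.le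
  -- Normalising to unit variance moves the scale `σ` into the test function `g`.
  set Y : Ω → ℝ := fun x => logRatio φ x / σ with hYdef
  have hY : Measurable Y := hXm.div_const σ
  have : IsProbabilityMeasure (Q.map Y) := Measure.isProbabilityMeasure_map hY.aemeasurable
  have hS : ∀ n : ℕ, Measurable fun x : Fin n → Ω => ∑ j, Y (x j) := fun n => by fun_prop
  have : ∀ n : ℕ, IsProbabilityMeasure
      ((Measure.pi fun _ : Fin n => Q).map fun x => ∑ j, Y (x j)) := fun n =>
    Measure.isProbabilityMeasure_map (hS n).aemeasurable
  have hm0 : ∫ s, s ∂(Q.map Y) = 0 := by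
    rw [integral_map hY.aemeasurable (by fun_prop), integral_div,
      integral_logRatio_tilted hφ hα hmin, zero_div]
  have hm1 : ∫ s, s ^ 2 ∂(Q.map Y) = 1 := by
    rw [integral_map hY.aemeasurable (by fun_prop)]
    simp only [hYdef, div_pow]
    rw [integral_div, ← hσ2, div_self (by positivity)]
  set g : ℝ → ℝ := fun s => min (Real.exp (-α * (σ * s))) (Real.exp ((1 - α) * (σ * s))) with hg
  have hgm : Measurable g := by fun_prop
  have hθ := integral_isTheta_inv_sqrt hm0 hm1
    (fun n t => charFun_map_sum_pi (Q := Q) hY n t) hgm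
    (mul_pos (lt_min hα.1 (sub_pos.2 hα.2)) hσ) hσ (min_exp_le hσ) (exp_le_min_exp hα hσ)
  have hη : ∀ n : ℕ, affinity (Measure.pi fun _ : Fin n => μ) (fun z => iidDensity n (φ z))
      = (∫ s, g s ∂((Measure.pi fun _ : Fin n => Q).map fun x => ∑ j, Y (x j)))
        * Real.exp (-(n * chernoffInfo μ φ)) := by
    intro n
    rw [affinity_eq hφ hα n, integral_map (hS n).aemeasurable hgm.aestronglyMeasurable,
      chernoffInfo_eq hφ hα hmin, mul_neg, neg_neg, Real.exp_nat_mul,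
      Real.exp_log (chernoffCoeff_pos hφ hα), mul_comm]
    congr 2
    ext x
    have : σ * ∑ j, Y (x j) = ∑ j, logRatio φ (x j) := by
      rw [Finset.mul_sum]
      exact Finset.sum_congr rfl fun j _ => mul_div_cancel₀ _ hσ.ne'
    simp only [hg, this]
  simp only [hη]
  exact hθ.mul (isTheta_refl _ _)

end Tilting

/-! ### Logarithmic expansions and the main theorem -/

lemma log_sub_isBigO_one_of_isTheta {u : ℕ → ℝ} (hu : ∀ n, 0 ≤ u n) {D : ℝ}
    (h : u =Θ[atTop] fun n : ℕ => 1 / √(n : ℝ) * Real.exp (-(n * D))) :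
    (fun n : ℕ => Real.log (u n) - (-(n * D) - 1 / 2 * Real.log n)) =O[atTop] fun _ => (1 : ℝ) := by
  obtain ⟨c, hc, hle⟩ := h.1.exists_pos
  obtain ⟨d, hd, hge⟩ := h.2.exists_pos
  have key : ∀ᶠ n : ℕ in atTop,
      ‖Real.log (u n) - (-(n * D) - 1 / 2 * Real.log n)‖ ≤ |Real.log c| + |Real.log d| := by
    filter_upwards [hle.bound, hge.bound, eventually_gt_atTop 0] with n h1 h2 hn
    have hn' : (0 : ℝ) < n := by exact_mod_cast hn
    set v : ℝ := 1 / √(n : ℝ) * Real.exp (-(n * D)) with hv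
    have hvpos : 0 < v := by positivity
    rw [Real.norm_eq_abs, Real.norm_eq_abs, abs_of_nonneg (hu n), abs_of_pos hvpos] at h1 h2
    -- The lower bound `v ≤ d * u n` with `v > 0` rules out `u n = 0`, so the logarithm is genuine.
    have hupos : 0 < u n := by
      by_contra! hneg
      nlinarith
    have hlogv : Real.log v = -(n * D) - 1 / 2 * Real.log n := by
      rw [hv, Real.log_mul (by positivity) (by positivity), Real.log_exp, Real.log_div one_ne_zero
        (by positivity), Real.log_one, Real.log_sqrt hn'.le]
      ring
    rw [← hlogv, Real.norm_eq_abs, abs_le]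
    have l1 := Real.log_le_log hupos h1
    have l2 := Real.log_le_log hvpos h2
    rw [Real.log_mul hc.ne' hvpos.ne'] at l1
    rw [Real.log_mul hd.ne' hupos.ne'] at l2
    have := le_abs_self (Real.log c)
    have := le_abs_self (Real.log d)
    have := abs_nonneg (Real.log c)
    have := abs_nonneg (Real.log d)
    constructor <;> linarith
  exact IsBigO.of_bound (|Real.log c| + |Real.log d|) (key.mono fun n hn => by simpa using hn)

end BayesChernoff

open BayesChernoff in
theorem mainTheorem2 {Ω : Type*} [MeasurableSpace Ω] (μ : Measure Ω) [SigmaFinite μ]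
    (φ : Fin 2 → Ω → ℝ) (hφ : IsAdmissible μ φ) :
    ((fun n : ℕ => affinity (Measure.pi fun _ : Fin n => μ) (fun z => iidDensity n (φ z)))
      =Θ[atTop] fun n : ℕ => 1 / √(n : ℝ) * Real.exp (-(n * chernoffInfo μ φ))) ∧
    ((fun n : ℕ =>
        Real.log (affinity (Measure.pi fun _ : Fin n => μ) (fun z => iidDensity n (φ z)))
          - (-(n * chernoffInfo μ φ) - 1 / 2 * Real.log n))
      =O[atTop] fun _ => (1 : ℝ)) ∧
    ∀ zhat : (n : ℕ) → (Fin n → Ω) → Fin 2,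
      (∀ n, IsBayesEstimator (fun z => iidDensity n (φ z)) (zhat n)) →
      (fun n : ℕ =>
        Real.log (errorProb (Measure.pi fun _ : Fin n => μ) (fun z => iidDensity n (φ z)) (zhat n))
          - (-(n * chernoffInfo μ φ) - 1 / 2 * Real.log n))
      =O[atTop] fun _ => (1 : ℝ) := by
  have h0 : ∀ n z (x : Fin n → Ω), 0 ≤ iidDensity n (φ z) x := fun n z x =>
    iidDensity_nonneg (hφ.isDensity z).nonneg n x
  have hΘ := affinity_isTheta hφ
  refine ⟨hΘ, log_sub_isBigO_one_of_isTheta (fun n => affinity_nonneg (h0 n)) hΘ, fun zhat hz => ?_⟩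
  have herr : ∀ n, errorProb (Measure.pi fun _ : Fin n => μ) (fun z => iidDensity n (φ z)) (zhat n)
      = 1 / 2 * affinity (Measure.pi fun _ : Fin n => μ) (fun z => iidDensity n (φ z)) := fun n =>
    errorProb_eq_affinity (fun z => measurable_iidDensity (hφ.isDensity z).measurable n) (h0 n)
      (integrable_iidDensity (hφ.isDensity 0).integrable n) (hz n)
  simp only [herr]
  refine log_sub_isBigO_one_of_isTheta
    (fun n => mul_nonneg (by norm_num) (affinity_nonneg (h0 n))) ?_
  -- The factor `1/2` is absorbed by the constants in `Θ`.
  exact hΘ.const_mul_left (by norm_num)
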